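/- Let $\mathcal H$ be a complex Hilbert space, let $A,B$ be compact self-adjoint operators on $\mathcal H$, and let $\rho$ be a state, i.e. a positive trace class operator with $\mathrm{tr}\,\rho=1$. For $a\in\sigma(A)$ let $P_A(a)$ be the spectral projection of $A$ at $a$ (the orthogonal projection onto $\ker(A-a)$), put $\Pi_A(a)(T)=P_A(a)\,T\,P_A(a)$ and $\Lambda_A(T)=\sum_{a\in\sigma(A)}\Pi_A(a)(T)$, and let $\mathrm{Inv}_A(\rho)=\|\Lambda_A(\rho)-\rho\|_1$ (trace norm) be the invasiveness of the projective measurement of $A$ in the state $\rho$; similarly for $B$. Let $$P_\rho^{A\to B}(a\to b)=\mathrm{tr}\bigl[\Pi_A(a)(\rho)\,P_B(b)\bigr],\qquad P_\rho^{B\to A}(b\to a)=\mathrm{tr}\bigl[\Pi_B(b)(\rho)\,P_A(a)\bigr]$$ be the operational joint probabilities of the two sequential projective measurements, and for $\alpha\in\mathbb R$ let $X\circ_\alpha Y=\alpha XY+(1-\alpha)YX$. Then the series defining $\Lambda_A(\rho)$ and $\Lambda_B(\rho)$ converge in trace norm and $\Lambda_A(\rho)-\rho$, $\Lambda_B(\rho)-\rho$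 are trace class, and for every $\alpha\in[0,1]$, $a\in\sigma(A)$ and $b\in\sigma(B)$, $$\bigl|P_\rho^{A\to B}(a\to b)-P_\rho^{B\to A}(b\to a)\bigr|\le\min\bigl\{\|[P_A(a),P_B(b)]\|,\ \|P_A(a)\circ_\alpha P_B(b)\|\bigr\}\,\bigl(\mathrm{Inv}_A(\rho)+\mathrm{Inv}_B(\rho)\bigr),$$ where $\|\cdot\|$ is the operator norm and $[X,Y]=XY-YX$. -/

import Mathlib

open Filter Topology

noncomputable section

namespace QuantumInvasiveness

variable {H : Type*} [NormedAddCommGroup H] [InnerProductSpace ℂ H] [CompleteSpace H]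

variable (H) in
/-- The index set of a fixed orthonormal (Hilbert) basis of `H`. -/
def basisIndex : Set H := Classical.choose (exists_hilbertBasis ℂ H)

variable (H) in
/-- A fixed orthonormal (Hilbert) basis of `H`, used to evaluate traces. -/
def stdBasis : HilbertBasis (basisIndex H) ℂ H :=
  Classical.choose (Classical.choose_spec (exists_hilbertBasis ℂ H))

/-- The trace norm `‖T‖₁ = tr |T| = ∑ᵢ ⟨eᵢ, |T| eᵢ⟩`, with `|T| = (T* T)^{1/2}`, as an element of
`[0, ∞]`. The terms are non-negative reals and the value does not depend on the basis. -/
def traceNorm (T : H →L[ℂ] H) : ENNReal :=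
  ∑' i, ENNReal.ofReal (RCLike.re (inner ℂ (stdBasis H i) (CFC.abs T (stdBasis H i))))

/-- `T` is a trace class operator: its trace norm is finite. -/
def IsTraceClass (T : H →L[ℂ] H) : Prop := traceNorm T ≠ ⊤

/-- The trace `tr T = ∑ᵢ ⟨eᵢ, T eᵢ⟩`. For a trace class operator the series converges absolutely
and its value does not depend on the basis. -/
def trace (T : H →L[ℂ] H) : ℂ :=
  ∑' i, inner ℂ (stdBasis H i) (T (stdBasis H i))

variable (H) in
/-- A quantum state: a positive trace class operator of trace one. -/
structure State where
  op : H →L[ℂ] H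
  isPositive : op.IsPositive
  isTraceClass : IsTraceClass op
  trace_eq_one : trace op = 1

/-- `P_A(a)`, the spectral projection of `A` at the point `a`: the orthogonal projection
onto the eigenspace `ker (a - A)`. It is zero if `a` is not an eigenvalue; for a compact self-adjoint
`A` that happens on the spectrum at most at `a = 0`. -/
def specProj (A : H →L[ℂ] H) (a : ℝ) : H →L[ℂ] H :=
  (LinearMap.ker (((a : ℂ) • (1 : H →L[ℂ] H) - A : H →L[ℂ] H) : H →ₗ[ℂ] H)).starProjection

/-- The Lüders projective measurement `Π_A = {Π_A(a)}` of `A`, indexed by the spectrum of `A`: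
`Π_A(a)(T) = P_A(a) T P_A(a)`. -/
def luders (A : H →L[ℂ] H) (a : spectrum ℝ A) (T : H →L[ℂ] H) : H →L[ℂ] H :=
  specProj A a * T * specProj A a

/-- The non-selective process `Λ_M(T) = ∑ₘ Mₘ(T)` of a measurement `M = {Mₘ}`.
The sum is the unordered sum in operator norm; a series that converges in trace norm
converges in operator norm to the same operator. -/
def nonselective {ι : Type*} (M : ι → (H →L[ℂ] H) → (H →L[ℂ] H)) (T : H →L[ℂ] H) : H →L[ℂ] H :=
  ∑' m, M m T

/-- The series `∑ₘ Tₘ` converges (unconditionally) to `S` in trace norm. -/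
def TraceNormHasSum {ι : Type*} (T : ι → H →L[ℂ] H) (S : H →L[ℂ] H) : Prop :=
  Tendsto (fun s : Finset ι => traceNorm ((∑ m ∈ s, T m) - S)) atTop (𝓝 0)

/-- The invasiveness `Inv_M(ρ) = ‖Λ_M(ρ) - ρ‖₁` of a measurement `M` in a state `ρ`. -/
def invasiveness {ι : Type*} (M : ι → (H →L[ℂ] H) → (H →L[ℂ] H)) (ρ : State H) : ℝ :=
  (traceNorm (nonselective M ρ.op - ρ.op)).toReal

/-- The operational joint probability `P_ρ^{A→B}(a→b) = tr[Π_A(a)(ρ) P_B(b)]` of the sequential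
projective measurement of `A` and then `B`. (It is a non-negative real, kept here as the complex
number given by the trace.) -/
def opProb (ρ : State H) (A B : H →L[ℂ] H) (a : spectrum ℝ A) (b : spectrum ℝ B) : ℂ :=
  trace (luders A a ρ.op * specProj B b)

/-- The product `X ∘_α Y = α X Y + (1 - α) Y X`. -/
def circ (α : ℝ) (X Y : H →L[ℂ] H) : H →L[ℂ] H :=
  (α : ℂ) • (X * Y) + ((1 - α : ℝ) : ℂ) • (Y * X)

end QuantumInvasiveness

end

namespace QuantumInvasiveness

variable {H : Type*} [NormedAddCommGroup H] [InnerProductSpace ℂ H] [CompleteSpace H]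

/-! Write `P`, `Q` for the two spectral projections, `σ = Λ_A(ρ)` and `τ = Λ_B(ρ)`. Orthogonality of
the spectral projections gives `P σ = P ρ P = σ P`, and likewise for `Q` and `τ`. Hence `tr(P ρ P
Q)` equals both `tr(σ P Q)` and `tr(σ Q P)`, so it equals `tr(σ (P ∘_α Q))`; symmetrically `tr(Q ρ Q
P) = tr(τ (P ∘_α Q))`. The difference is `tr((σ - τ)(P ∘_α Q))`, and Hölder with the triangle
inequality through `ρ` gives the second bound.

For the commutator, `P Q P - Q P Q = [P,Q] Q - P [P,Q]`, while `tr(σ P [P,Q]) = 0 = tr(τ [P,Q] Q)`.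
The difference is therefore `tr((σ - ρ) P [P,Q]) - tr((τ - ρ) [P,Q] Q)`, and Hölder applies to each
term.

The trace class theory needed (cyclicity, Hölder, triangle inequality) is developed for self-adjoint
operators only: a positive operator is the square of its root, which is Hilbert-Schmidt when the
trace is finite, and the general case follows from `D = D⁺ - D⁻`. -/

/-- The trace of a positive operator, as an element of `[0, ∞]`. -/
noncomputable def posTrace (T : H →L[ℂ] H) : ENNReal :=
  ∑' i, ENNReal.ofReal (RCLike.re (inner ℂ (stdBasis H i) (T (stdBasis H i))))

/-- The square of the Hilbert-Schmidt norm, as an element of `[0, ∞]`. -/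
noncomputable def hsSq (S : H →L[ℂ] H) : ENNReal :=
  ∑' i, ENNReal.ofReal (‖S (stdBasis H i)‖ ^ 2)

/-! ### Parseval's identity and the Hilbert-Schmidt norm -/

theorem hasSum_norm_inner_sq (x : H) :
    HasSum (fun i => ‖inner ℂ (stdBasis H i) x‖ ^ 2) (‖x‖ ^ 2) := by
  have h := (stdBasis H).hasSum_inner_mul_inner x x
  have h2 := Complex.hasSum_re h
  convert h2 using 1
  · ext i
    rw [← inner_conj_symm x, ← Complex.normSq_eq_conj_mul_self, Complex.ofReal_re,
      Complex.normSq_eq_norm_sq]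
  · rw [inner_self_eq_norm_sq_to_K]
    norm_cast

theorem tsum_ofReal_norm_inner_sq (x : H) :
    ∑' i, ENNReal.ofReal (‖inner ℂ (stdBasis H i) x‖ ^ 2) = ENNReal.ofReal (‖x‖ ^ 2) := by
  rw [← ENNReal.ofReal_tsum_of_nonneg (fun _ => by positivity) (hasSum_norm_inner_sq x).summable,
    (hasSum_norm_inner_sq x).tsum_eq]

/-- By Parseval both sides are the sum of all squared matrix entries; taking the adjoint only
exchanges the order of summation. -/
theorem hsSq_star (S : H →L[ℂ] H) : hsSq (star S) = hsSq S := by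
  unfold hsSq
  have e (T : H →L[ℂ] H) (i : basisIndex H) := tsum_ofReal_norm_inner_sq (T (stdBasis H i))
  rw [← tsum_congr (e S), ← tsum_congr (e (star S)), ENNReal.tsum_comm]
  refine tsum_congr fun i => tsum_congr fun j => ?_
  rw [ContinuousLinearMap.star_eq_adjoint, ContinuousLinearMap.adjoint_inner_right,
    norm_inner_symm]

theorem hsSq_mul_le (X S : H →L[ℂ] H) :
    hsSq (X * S) ≤ ENNReal.ofReal (‖X‖ ^ 2) * hsSq S := by
  unfold hsSq
  rw [← ENNReal.tsum_mul_left]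
  refine ENNReal.tsum_le_tsum fun i => ?_
  rw [← ENNReal.ofReal_mul (by positivity), ← mul_pow]
  gcongr
  exact X.le_opNorm _

theorem hsSq_mul_le' (S X : H →L[ℂ] H) :
    hsSq (S * X) ≤ ENNReal.ofReal (‖X‖ ^ 2) * hsSq S := by
  rw [← hsSq_star, star_mul]
  refine (hsSq_mul_le _ _).trans_eq ?_
  rw [hsSq_star, norm_star]

theorem hsSq_mul_ne_top (X : H →L[ℂ] H) {S : H →L[ℂ] H} (hS : hsSq S ≠ ⊤) : hsSq (X * S) ≠ ⊤ :=
  ne_top_of_le_ne_top (ENNReal.mul_ne_top ENNReal.ofReal_ne_top hS) (hsSq_mul_le X S)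

theorem hsSq_mul_ne_top' {S : H →L[ℂ] H} (hS : hsSq S ≠ ⊤) (X : H →L[ℂ] H) : hsSq (S * X) ≠ ⊤ :=
  ne_top_of_le_ne_top (ENNReal.mul_ne_top ENNReal.ofReal_ne_top hS) (hsSq_mul_le' S X)

theorem posTrace_star_mul_self (S : H →L[ℂ] H) : posTrace (star S * S) = hsSq S := by
  unfold posTrace hsSq
  refine tsum_congr fun i => ?_
  rw [ContinuousLinearMap.star_eq_adjoint, mul_apply_eq_comp,
    ContinuousLinearMap.adjoint_inner_right, inner_self_eq_norm_sq]

theorem summable_norm_sq {S : H →L[ℂ] H} (hS : hsSq S ≠ ⊤) :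
    Summable fun i => ‖S (stdBasis H i)‖ ^ 2 := by
  have := ENNReal.summable_toReal hS
  simpa [ENNReal.toReal_ofReal] using this

theorem hsSq_eq_ofReal {S : H →L[ℂ] H} (hS : hsSq S ≠ ⊤) :
    hsSq S = ENNReal.ofReal (∑' i, ‖S (stdBasis H i)‖ ^ 2) :=
  (ENNReal.ofReal_tsum_of_nonneg (fun _ => by positivity) (summable_norm_sq hS)).symm

/-! ### Diagonals and traces of products of Hilbert-Schmidt operators -/

/-- The diagonal of `T` with respect to the fixed basis. -/
noncomputable def diag (T : H →L[ℂ] H) (i : basisIndex H) : ℂ :=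
  inner ℂ (stdBasis H i) (T (stdBasis H i))

theorem trace_eq_tsum_diag (T : H →L[ℂ] H) : trace T = ∑' i, diag T i := rfl

theorem diag_add (S T : H →L[ℂ] H) : diag (S + T) = fun i => diag S i + diag T i := by
  ext i; simp [diag]

theorem diag_sub (S T : H →L[ℂ] H) : diag (S - T) = fun i => diag S i - diag T i := by
  ext i; simp [diag]

theorem diag_smul (c : ℂ) (T : H →L[ℂ] H) : diag (c • T) = fun i => c * diag T i := by
  ext i; simp [diag]

theorem diag_mul (R S : H →L[ℂ] H) (i : basisIndex H) :
    diag (R * S) i = inner ℂ (star R (stdBasis H i)) (S (stdBasis H i)) := by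
  rw [diag, ContinuousLinearMap.star_eq_adjoint, mul_apply_eq_comp,
    ContinuousLinearMap.adjoint_inner_left]

/-- Cauchy-Schwarz, then the weighted inequality `2ab ≤ c a² + c⁻¹ b²`. Keeping the weight `c` free
lets the sharp constant in Hölder's inequality be recovered after summation. -/
theorem norm_diag_mul_le (R S : H →L[ℂ] H) {c : ℝ} (hc : 0 < c) (i : basisIndex H) :
    ‖diag (R * S) i‖ ≤
      (c * ‖star R (stdBasis H i)‖ ^ 2 + c⁻¹ * ‖S (stdBasis H i)‖ ^ 2) / 2 := by
  rw [diag_mul]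
  refine (norm_inner_le_norm _ _).trans ?_
  set a := ‖star R (stdBasis H i)‖
  set b := ‖S (stdBasis H i)‖
  have h : 0 ≤ c⁻¹ * (c * a - b) ^ 2 := by positivity
  have h2 : c⁻¹ * (c * a - b) ^ 2 = c * a ^ 2 + c⁻¹ * b ^ 2 - 2 * (a * b) := by
    field_simp
    ring
  linarith

theorem summable_diag_mul {R S : H →L[ℂ] H} (hR : hsSq R ≠ ⊤) (hS : hsSq S ≠ ⊤) :
    Summable (diag (R * S)) := by
  rw [← hsSq_star] at hR
  exact Summable.of_norm_bounded
    ((((summable_norm_sq hR).mul_left 1).add ((summable_norm_sq hS).mul_left 1⁻¹)).div_const 2)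
    (norm_diag_mul_le R S one_pos)

theorem norm_trace_mul_le {R S : H →L[ℂ] H} (hR : hsSq R ≠ ⊤) (hS : hsSq S ≠ ⊤)
    {c : ℝ} (hc : 0 < c) :
    ‖trace (R * S)‖ ≤ (c * (hsSq R).toReal + c⁻¹ * (hsSq S).toReal) / 2 := by
  rw [← hsSq_star R]
  rw [← hsSq_star] at hR
  have h := (((summable_norm_sq hR).hasSum.mul_left c).add
    ((summable_norm_sq hS).hasSum.mul_left c⁻¹)).div_const 2
  rw [hsSq_eq_ofReal hR, hsSq_eq_ofReal hS,
    ENNReal.toReal_ofReal (tsum_nonneg fun _ => by positivity),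
    ENNReal.toReal_ofReal (tsum_nonneg fun _ => by positivity)]
  exact tsum_of_norm_bounded h (norm_diag_mul_le R S hc)

theorem diag_mul_eq_tsum (R S : H →L[ℂ] H) (i : basisIndex H) :
    diag (R * S) i = ∑' j, inner ℂ (stdBasis H i) (R (stdBasis H j)) *
      inner ℂ (stdBasis H j) (S (stdBasis H i)) := by
  rw [diag_mul, ← (stdBasis H).tsum_inner_mul_inner]
  refine tsum_congr fun j => ?_
  rw [ContinuousLinearMap.star_eq_adjoint, ContinuousLinearMap.adjoint_inner_left]

theorem summable_norm_matrix_sq {S : H →L[ℂ] H} (hS : hsSq S ≠ ⊤) :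
    Summable fun p : basisIndex H × basisIndex H =>
      ‖inner ℂ (stdBasis H p.2) (S (stdBasis H p.1))‖ ^ 2 := by
  have h0 : ∀ p : basisIndex H × basisIndex H,
      0 ≤ ‖inner ℂ (stdBasis H p.2) (S (stdBasis H p.1))‖ ^ 2 := fun p => pow_nonneg (norm_nonneg _) 2
  have h1 (i : basisIndex H) := hasSum_norm_inner_sq (S (stdBasis H i))
  have h2 : Summable fun i => ∑' j, ‖inner ℂ (stdBasis H j) (S (stdBasis H i))‖ ^ 2 :=
    (summable_norm_sq hS).congr fun i => (h1 i).tsum_eq.symm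
  exact (summable_prod_of_nonneg h0).mpr ⟨fun i => (h1 i).summable, h2⟩

/-- Both traces are the same double series of matrix entries, summed in opposite orders;
square-summability of the entries makes it absolutely convergent. -/
theorem trace_mul_comm_of_hsSq {R S : H →L[ℂ] H} (hR : hsSq R ≠ ⊤) (hS : hsSq S ≠ ⊤) :
    trace (R * S) = trace (S * R) := by
  simp only [trace_eq_tsum_diag, diag_mul_eq_tsum]
  have hR' := (Equiv.prodComm _ _).summable_iff.mpr (summable_norm_matrix_sq hR)
  have h : Summable (Function.uncurry fun i j : basisIndex H =>
      inner ℂ (stdBasis H i) (R (stdBasis H j)) * inner ℂ (stdBasis H j) (S (stdBasis H i))) := by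
    refine Summable.of_norm_bounded (hR'.add (summable_norm_matrix_sq hS)) fun p => ?_
    simp only [Function.uncurry, norm_mul, Function.comp_apply, Equiv.prodComm_apply, Prod.fst_swap,
      Prod.snd_swap]
    nlinarith [sq_nonneg (‖inner ℂ (stdBasis H p.1) (R (stdBasis H p.2))‖ -
      ‖inner ℂ (stdBasis H p.2) (S (stdBasis H p.1))‖),
      sq_nonneg ‖inner ℂ (stdBasis H p.1) (R (stdBasis H p.2))‖,
      sq_nonneg ‖inner ℂ (stdBasis H p.2) (S (stdBasis H p.1))‖]
  refine (Summable.tsum_comm h).symm.trans ?_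
  exact tsum_congr fun i => tsum_congr fun j => mul_comm _ _

theorem opNorm_sq_le_hsSq (S : H →L[ℂ] H) : ENNReal.ofReal (‖S‖ ^ 2) ≤ hsSq S := by
  by_cases hS : hsSq S = ⊤
  · simp [hS]
  rw [hsSq_eq_ofReal hS]
  refine ENNReal.ofReal_le_ofReal ?_
  set h := ∑' i, ‖S (stdBasis H i)‖ ^ 2 with hh
  have h0 : 0 ≤ h := tsum_nonneg fun _ => by positivity
  -- The adjoint is easier to bound: the coefficients of `star S y` are `⟨S eᵢ, y⟩`, each at most
  -- `‖S eᵢ‖ ‖y‖`.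
  have key : ‖star S‖ ≤ Real.sqrt h := by
    refine ContinuousLinearMap.opNorm_le_bound _ (Real.sqrt_nonneg _) fun y => ?_
    refine Real.le_sqrt_of_sq_le ?_ |>.trans_eq (b := Real.sqrt (h * ‖y‖ ^ 2)) ?_
    · rw [← (hasSum_norm_inner_sq (star S y)).tsum_eq, hh, ← tsum_mul_right]
      refine (hasSum_norm_inner_sq _).summable.tsum_le_tsum (fun i => ?_)
        ((summable_norm_sq hS).mul_right _)
      rw [ContinuousLinearMap.star_eq_adjoint, ContinuousLinearMap.adjoint_inner_right, ← mul_pow]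
      gcongr
      exact norm_inner_le_norm _ _
    · rw [Real.sqrt_mul h0, Real.sqrt_sq (norm_nonneg _)]
  rw [norm_star] at key
  calc ‖S‖ ^ 2 ≤ Real.sqrt h ^ 2 := by gcongr
    _ = h := Real.sq_sqrt h0

/-! ### Positive operators -/

theorem exists_sq_of_nonneg {T : H →L[ℂ] H} (hT : 0 ≤ T) :
    ∃ S : H →L[ℂ] H, star S = S ∧ S * S = T ∧ posTrace T = hsSq S := by
  have h := (CFC.sqrt_nonneg T).isSelfAdjoint.star_eq
  refine ⟨CFC.sqrt T, h, CFC.sqrt_mul_sqrt_self T hT, ?_⟩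
  conv_lhs => rw [← CFC.sqrt_mul_sqrt_self T hT]
  rw [← posTrace_star_mul_self, h]

omit [CompleteSpace H] in
theorem re_inner_nonneg {T : H →L[ℂ] H} (hT : 0 ≤ T) (x : H) :
    0 ≤ RCLike.re (inner ℂ x (T x)) :=
  ((ContinuousLinearMap.nonneg_iff_isPositive T).mp hT).re_inner_nonneg_right x

theorem posTrace_add {S T : H →L[ℂ] H} (hS : 0 ≤ S) (hT : 0 ≤ T) :
    posTrace (S + T) = posTrace S + posTrace T := by
  unfold posTrace
  rw [← ENNReal.tsum_add]
  refine tsum_congr fun i => ?_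
  rw [← ENNReal.ofReal_add (re_inner_nonneg hS _) (re_inner_nonneg hT _)]
  simp

theorem posTrace_eq_tsum {ι : Type*} {T : ι → H →L[ℂ] H} {S : H →L[ℂ] H} (hT : ∀ a, 0 ≤ T a)
    (h : HasSum T S) : posTrace S = ∑' a, posTrace (T a) := by
  unfold posTrace
  rw [ENNReal.tsum_comm]
  refine tsum_congr fun i => ?_
  have h1 : HasSum (fun a => RCLike.re (inner ℂ (stdBasis H i) (T a (stdBasis H i))))
      (RCLike.re (inner ℂ (stdBasis H i) (S (stdBasis H i)))) := by
    have h2 := h.mapL (ContinuousLinearMap.apply ℂ H (stdBasis H i))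
    have h3 := h2.mapL (innerSL ℂ (stdBasis H i))
    exact Complex.hasSum_re h3
  rw [← h1.tsum_eq, ENNReal.ofReal_tsum_of_nonneg (fun a => re_inner_nonneg (hT a) _) h1.summable]

theorem norm_le_posTrace {T : H →L[ℂ] H} (hT : 0 ≤ T) : ENNReal.ofReal ‖T‖ ≤ posTrace T := by
  obtain ⟨S, hS, rfl, h⟩ := exists_sq_of_nonneg hT
  rw [h]
  refine le_trans (ENNReal.ofReal_le_ofReal ?_) (opNorm_sq_le_hsSq S)
  rw [sq]
  exact norm_mul_le _ _

theorem summable_diag_of_nonneg {T : H →L[ℂ] H} (hT : 0 ≤ T) (h : posTrace T ≠ ⊤)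
    (X Y : H →L[ℂ] H) : Summable (diag (X * T * Y)) := by
  obtain ⟨S, hS, rfl, h'⟩ := exists_sq_of_nonneg hT
  rw [h'] at h
  have := summable_diag_mul (hsSq_mul_ne_top X h) (hsSq_mul_ne_top' h Y)
  simpa only [mul_assoc] using this

/-- Split `T = S * S` with `S` Hilbert-Schmidt, so that every swap exchanges two Hilbert-Schmidt
factors, even though `X` and `Y` are merely bounded. -/
theorem trace_cyclic_of_nonneg {T : H →L[ℂ] H} (hT : 0 ≤ T) (h : posTrace T ≠ ⊤)
    (X Y : H →L[ℂ] H) : trace (X * T * Y) = trace (T * (Y * X)) := by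
  obtain ⟨S, hS, rfl, h'⟩ := exists_sq_of_nonneg hT
  rw [h'] at h
  have h1 := trace_mul_comm_of_hsSq (hsSq_mul_ne_top X h) (hsSq_mul_ne_top' h Y)
  have h2 := trace_mul_comm_of_hsSq (hsSq_mul_ne_top' (hsSq_mul_ne_top' h Y) X) h
  have h3 := trace_mul_comm_of_hsSq h (hsSq_mul_ne_top' h (Y * X))
  simp only [mul_assoc] at h1 h2 h3 ⊢
  rw [h1, h2, h3]

theorem norm_trace_mul_le_of_nonneg {T : H →L[ℂ] H} (hT : 0 ≤ T) (h : posTrace T ≠ ⊤)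
    (X : H →L[ℂ] H) : ‖trace (T * X)‖ ≤ ‖X‖ * (posTrace T).toReal := by
  obtain ⟨S, hS, rfl, h'⟩ := exists_sq_of_nonneg hT
  rw [h'] at h ⊢
  have hSX : (hsSq (S * X)).toReal ≤ ‖X‖ ^ 2 * (hsSq S).toReal := by
    have := ENNReal.toReal_mono (ENNReal.mul_ne_top ENNReal.ofReal_ne_top h) (hsSq_mul_le' S X)
    rwa [ENNReal.toReal_mul, ENNReal.toReal_ofReal (by positivity)] at this
  rcases (norm_nonneg X).eq_or_lt with hX | hX
  · have : X = 0 := norm_eq_zero.mp hX.symm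
    simp [this, trace]
  -- The weight `c = ‖X‖` balances the two terms: each is at most `‖X‖ * hsSq S`.
  have := norm_trace_mul_le h (hsSq_mul_ne_top' h X) hX
  rw [mul_assoc]
  refine this.trans ?_
  have h2 : ‖X‖⁻¹ * (hsSq (S * X)).toReal ≤ ‖X‖⁻¹ * (‖X‖ ^ 2 * (hsSq S).toReal) := by gcongr
  have h3 : ‖X‖⁻¹ * (‖X‖ ^ 2 * (hsSq S).toReal) = ‖X‖ * (hsSq S).toReal := by field_simp
  linarith

/-! ### Self-adjoint operators -/

theorem traceNorm_eq_posTrace_abs (T : H →L[ℂ] H) : traceNorm T = posTrace (CFC.abs T) := rfl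

theorem traceNorm_of_nonneg {T : H →L[ℂ] H} (hT : 0 ≤ T) : traceNorm T = posTrace T := by
  rw [traceNorm_eq_posTrace_abs, CFC.abs_of_nonneg T hT]

theorem traceNorm_neg (T : H →L[ℂ] H) : traceNorm (-T) = traceNorm T := by
  rw [traceNorm_eq_posTrace_abs, CFC.abs_neg, traceNorm_eq_posTrace_abs]

theorem traceNorm_eq_posPart_add_negPart {D : H →L[ℂ] H} (hD : IsSelfAdjoint D) :
    traceNorm D = posTrace D⁺ + posTrace D⁻ := by
  rw [traceNorm_eq_posTrace_abs, ← CFC.posPart_add_negPart D hD,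
    posTrace_add (CFC.posPart_nonneg D) (CFC.negPart_nonneg D)]

/-- Polar decomposition of a self-adjoint operator, with a reflection as the unitary part. -/
theorem exists_mul_eq_abs {D : H →L[ℂ] H} (hD : IsSelfAdjoint D) :
    ∃ U : H →L[ℂ] H, ‖U‖ ≤ 1 ∧ CFC.abs D = U * D := by
  -- Reflection in `ker D⁻` fixes the range of `D⁺`, since `D⁻ D⁺ = 0`, and negates the range of
  -- `D⁻`, which is orthogonal to `ker D⁻`. So it sends `D⁺ - D⁻` to `D⁺ + D⁻`.
  set K : Submodule ℂ H := LinearMap.ker (D⁻ : H →L[ℂ] H).toLinearMap with hK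
  have : IsClosed (K : Set H) := (D⁻).isClosed_ker
  have : CompleteSpace K := this.completeSpace_coe
  refine ⟨K.reflection.toContinuousLinearEquiv.toContinuousLinearMap, ?_, ?_⟩
  · exact ContinuousLinearMap.opNorm_le_bound _ zero_le_one fun x => by simp
  have hpos (x : H) : K.reflection (D⁺ x) = D⁺ x := by
    refine K.reflection_mem_subspace_eq_self ?_
    change D⁻ (D⁺ x) = 0
    rw [← mul_apply_eq_comp, CFC.negPart_mul_posPart]
    rfl
  have hneg (x : H) : K.reflection (D⁻ x) = -D⁻ x := by
    refine K.reflection_mem_subspace_orthogonalComplement_eq_neg ?_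
    rw [Submodule.mem_orthogonal]
    intro u hu
    have hsa : IsSelfAdjoint D⁻ := (CFC.negPart_nonneg D).isSelfAdjoint
    rw [← ContinuousLinearMap.adjoint_inner_left, hsa.adjoint_eq]
    have hu' : D⁻ u = 0 := hu
    rw [hu', inner_zero_left]
  ext x
  rw [← CFC.posPart_add_negPart D hD]
  conv_rhs => rw [← CFC.posPart_sub_negPart D hD]
  simp [hpos, hneg]

/-- With `|P - N| = U (P - N)` and `‖U‖ ≤ 1`, the trace norm is `tr(U P) - tr(U N)`, and each term
is bounded by Hölder for positive operators. `P` and `N` need not be the positive and negative parts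
of `P - N`, which is what the triangle inequality requires. -/
theorem traceNorm_sub_le {P N : H →L[ℂ] H} (hP : 0 ≤ P) (hN : 0 ≤ N) :
    traceNorm (P - N) ≤ posTrace P + posTrace N := by
  by_cases hPt : posTrace P = ⊤
  · simp [hPt]
  by_cases hNt : posTrace N = ⊤
  · simp [hNt]
  obtain ⟨U, hU, hUD⟩ := exists_mul_eq_abs (hP.isSelfAdjoint.sub hN.isSelfAdjoint)
  have h1 : Summable (diag (U * P)) := by simpa using summable_diag_of_nonneg hP hPt U 1
  have h2 : Summable (diag (U * N)) := by simpa using summable_diag_of_nonneg hN hNt U 1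
  have hs : HasSum (diag (CFC.abs (P - N))) (trace (U * P) - trace (U * N)) := by
    rw [hUD, mul_sub, diag_sub]
    exact h1.hasSum.sub h2.hasSum
  have bound {T : H →L[ℂ] H} (hT : 0 ≤ T) (hTt : posTrace T ≠ ⊤) :
      ‖trace (U * T)‖ ≤ (posTrace T).toReal := by
    have e : trace (U * T) = trace (T * U) := by
      simpa using trace_cyclic_of_nonneg hT hTt U 1
    rw [e]
    refine (norm_trace_mul_le_of_nonneg hT hTt U).trans ?_
    exact mul_le_of_le_one_left ENNReal.toReal_nonneg hU
  have hre := Complex.hasSum_re hs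
  have e : traceNorm (P - N) = ENNReal.ofReal (trace (U * P) - trace (U * N)).re := by
    have hnn (i : basisIndex H) : 0 ≤ (diag (CFC.abs (P - N)) i).re :=
      re_inner_nonneg (CFC.abs_nonneg (P - N)) _
    rw [← hre.tsum_eq, ENNReal.ofReal_tsum_of_nonneg hnn hre.summable]
    rfl
  rw [e, ← ENNReal.ofReal_toReal hPt, ← ENNReal.ofReal_toReal hNt,
    ← ENNReal.ofReal_add ENNReal.toReal_nonneg ENNReal.toReal_nonneg]
  refine ENNReal.ofReal_le_ofReal ?_
  refine (Complex.re_le_norm _).trans ((norm_sub_le _ _).trans ?_)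
  exact add_le_add (bound hP hPt) (bound hN hNt)

theorem traceNorm_add_le {C D : H →L[ℂ] H} (hC : IsSelfAdjoint C) (hD : IsSelfAdjoint D) :
    traceNorm (C + D) ≤ traceNorm C + traceNorm D := by
  have e : C + D = (C⁺ + D⁺) - (C⁻ + D⁻) := by
    conv_lhs => rw [← CFC.posPart_sub_negPart C hC, ← CFC.posPart_sub_negPart D hD]
    abel
  have p (T : H →L[ℂ] H) := CFC.posPart_nonneg T
  have n (T : H →L[ℂ] H) := CFC.negPart_nonneg T
  rw [e]
  refine (traceNorm_sub_le (add_nonneg (p C) (p D)) (add_nonneg (n C) (n D))).trans_eq ?_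
  rw [posTrace_add (p C) (p D), posTrace_add (n C) (n D), traceNorm_eq_posPart_add_negPart hC,
    traceNorm_eq_posPart_add_negPart hD]
  abel

theorem IsTraceClass.posTrace_parts_ne_top {D : H →L[ℂ] H} (h : IsTraceClass D)
    (hD : IsSelfAdjoint D) : posTrace D⁺ ≠ ⊤ ∧ posTrace D⁻ ≠ ⊤ := by
  rw [IsTraceClass, traceNorm_eq_posPart_add_negPart hD] at h
  exact ENNReal.add_ne_top.mp h

theorem IsTraceClass.summable_diag {D : H →L[ℂ] H} (h : IsTraceClass D) (hD : IsSelfAdjoint D)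
    (X Y : H →L[ℂ] H) : Summable (diag (X * D * Y)) := by
  obtain ⟨h1, h2⟩ := h.posTrace_parts_ne_top hD
  rw [← CFC.posPart_sub_negPart D hD, mul_sub, sub_mul, diag_sub]
  exact (summable_diag_of_nonneg (CFC.posPart_nonneg D) h1 X Y).sub
    (summable_diag_of_nonneg (CFC.negPart_nonneg D) h2 X Y)

theorem IsTraceClass.summable_diag_mul {D : H →L[ℂ] H} (h : IsTraceClass D)
    (hD : IsSelfAdjoint D) (X : H →L[ℂ] H) : Summable (diag (D * X)) := by
  simpa using h.summable_diag hD 1 X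

theorem trace_sub {S T : H →L[ℂ] H} (hS : Summable (diag S)) (hT : Summable (diag T)) :
    trace (S - T) = trace S - trace T := by
  rw [trace_eq_tsum_diag, diag_sub]
  exact hS.tsum_sub hT

theorem trace_add {S T : H →L[ℂ] H} (hS : Summable (diag S)) (hT : Summable (diag T)) :
    trace (S + T) = trace S + trace T := by
  rw [trace_eq_tsum_diag, diag_add]
  exact hS.tsum_add hT

theorem trace_smul (c : ℂ) (T : H →L[ℂ] H) : trace (c • T) = c * trace T := by
  rw [trace_eq_tsum_diag, diag_smul, tsum_mul_left, trace_eq_tsum_diag]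

theorem IsTraceClass.trace_cyclic {D : H →L[ℂ] H} (h : IsTraceClass D) (hD : IsSelfAdjoint D)
    (X Y : H →L[ℂ] H) : trace (X * D * Y) = trace (D * (Y * X)) := by
  obtain ⟨h1, h2⟩ := h.posTrace_parts_ne_top hD
  have p := CFC.posPart_nonneg D
  have n := CFC.negPart_nonneg D
  have s {T : H →L[ℂ] H} (hT : 0 ≤ T) (ht : posTrace T ≠ ⊤) : Summable (diag (T * (Y * X))) := by
    simpa using summable_diag_of_nonneg hT ht 1 (Y * X)
  rw [← CFC.posPart_sub_negPart D hD, mul_sub, sub_mul, sub_mul,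
    trace_sub (summable_diag_of_nonneg p h1 X Y) (summable_diag_of_nonneg n h2 X Y),
    trace_sub (s p h1) (s n h2), trace_cyclic_of_nonneg p h1, trace_cyclic_of_nonneg n h2]

/-- Hölder's inequality for the trace of a self-adjoint trace class and a bounded operator. -/
theorem IsTraceClass.norm_trace_mul_le {D : H →L[ℂ] H} (h : IsTraceClass D)
    (hD : IsSelfAdjoint D) (X : H →L[ℂ] H) :
    ‖trace (D * X)‖ ≤ ‖X‖ * (traceNorm D).toReal := by
  obtain ⟨h1, h2⟩ := h.posTrace_parts_ne_top hD
  have p := CFC.posPart_nonneg D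
  have n := CFC.negPart_nonneg D
  have s {T : H →L[ℂ] H} (hT : 0 ≤ T) (ht : posTrace T ≠ ⊤) : Summable (diag (T * X)) := by
    simpa using summable_diag_of_nonneg hT ht 1 X
  rw [traceNorm_eq_posPart_add_negPart hD, ENNReal.toReal_add h1 h2, mul_add]
  conv_lhs => rw [← CFC.posPart_sub_negPart D hD]
  rw [sub_mul, trace_sub (s p h1) (s n h2)]
  exact (norm_sub_le _ _).trans (add_le_add (norm_trace_mul_le_of_nonneg p h1 X)
    (norm_trace_mul_le_of_nonneg n h2 X))

theorem IsTraceClass.add {C D : H →L[ℂ] H} (hCt : IsTraceClass C) (hDt : IsTraceClass D)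
    (hC : IsSelfAdjoint C) (hD : IsSelfAdjoint D) : IsTraceClass (C + D) :=
  ne_top_of_le_ne_top (ENNReal.add_ne_top.mpr ⟨hCt, hDt⟩) (traceNorm_add_le hC hD)

theorem IsTraceClass.neg {D : H →L[ℂ] H} (h : IsTraceClass D) : IsTraceClass (-D) := by
  rwa [IsTraceClass, traceNorm_neg]

theorem IsTraceClass.sub {C D : H →L[ℂ] H} (hCt : IsTraceClass C) (hDt : IsTraceClass D)
    (hC : IsSelfAdjoint C) (hD : IsSelfAdjoint D) : IsTraceClass (C - D) := by
  rw [sub_eq_add_neg]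
  exact hCt.add hDt.neg hC hD.neg

/-! ### Families of orthogonal projections -/

/-- Bessel's inequality: the finite sum `E` is again a projection, so `1 - E = (1 - E)* (1 - E)` is
positive. -/
theorem sum_norm_sq_le_of_orthogonal {ι : Type*} {P : ι → H →L[ℂ] H}
    (hsa : ∀ a, IsSelfAdjoint (P a)) (hid : ∀ a, P a * P a = P a)
    (hort : Pairwise fun a b => P a * P b = 0) (s : Finset ι) (x : H) :
    ∑ a ∈ s, ‖P a x‖ ^ 2 ≤ ‖x‖ ^ 2 := by
  classical
  set E := ∑ a ∈ s, P a with hE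
  have hEsa : IsSelfAdjoint E := isSelfAdjoint_sum s fun a _ => hsa a
  have hEE : E * E = E := by
    rw [hE, Finset.sum_mul]
    refine Finset.sum_congr rfl fun a ha => ?_
    rw [Finset.mul_sum, Finset.sum_eq_single a (fun b _ hb => hort hb.symm)
      (fun h => absurd ha h), hid]
  have h0 : 0 ≤ 1 - E := by
    have h : star (1 - E) * (1 - E) = 1 - E := by
      rw [star_sub, star_one, hEsa.star_eq, mul_sub, sub_mul, sub_mul, hEE]
      simp
    rw [← h]
    exact star_mul_self_nonneg _
  have h1 := re_inner_nonneg h0 x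
  have h2 (a : ι) : ‖P a x‖ ^ 2 = RCLike.re (inner ℂ x (P a x)) := by
    rw [← inner_self_eq_norm_sq (𝕜 := ℂ), ← ContinuousLinearMap.adjoint_inner_right,
      (hsa a).adjoint_eq, ← mul_apply_eq_comp, hid]
  have h3 : RCLike.re (inner ℂ x ((1 - E) x)) = ‖x‖ ^ 2 - ∑ a ∈ s, ‖P a x‖ ^ 2 := by
    rw [Finset.sum_congr rfl fun a _ => h2 a, ← inner_self_eq_norm_sq (𝕜 := ℂ) x]
    simp [hE]
  linarith

/-- For `T = S * S` the summand is the squared Hilbert-Schmidt norm of `P a * S`; Bessel's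
inequality applies to each vector `S eᵢ`. -/
theorem tsum_posTrace_conj_le {ι : Type*} {P : ι → H →L[ℂ] H}
    (hsa : ∀ a, IsSelfAdjoint (P a)) (hid : ∀ a, P a * P a = P a)
    (hort : Pairwise fun a b => P a * P b = 0) {T : H →L[ℂ] H} (hT : 0 ≤ T) :
    ∑' a, posTrace (P a * T * P a) ≤ posTrace T := by
  obtain ⟨S, hS, rfl, h⟩ := exists_sq_of_nonneg hT
  have h1 (a : ι) : posTrace (P a * (S * S) * P a) = hsSq (P a * S) := by
    rw [← hsSq_star, star_mul, hS, (hsa a).star_eq, ← posTrace_star_mul_self, star_mul, hS,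
      (hsa a).star_eq]
    simp only [mul_assoc]
  rw [h, tsum_congr h1]
  unfold hsSq
  rw [ENNReal.tsum_comm]
  refine ENNReal.tsum_le_tsum fun i => ?_
  rw [ENNReal.tsum_eq_iSup_sum]
  refine iSup_le fun s => ?_
  rw [← ENNReal.ofReal_sum_of_nonneg fun _ _ => by positivity]
  exact ENNReal.ofReal_le_ofReal (sum_norm_sq_le_of_orthogonal hsa hid hort s _)

theorem summable_of_tsum_posTrace_ne_top {ι : Type*} {T : ι → H →L[ℂ] H} (hT : ∀ a, 0 ≤ T a)
    (h : ∑' a, posTrace (T a) ≠ ⊤) : Summable T := by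
  refine Summable.of_norm_bounded (ENNReal.summable_toReal h) fun a => ?_
  rw [← ENNReal.ofReal_le_iff_le_toReal (ENNReal.ne_top_of_tsum_ne_top h a)]
  exact norm_le_posTrace (hT a)

/-- The remainder after a finite partial sum is positive, so its trace norm is its trace, which is
the tail of a convergent series. -/
theorem traceNormHasSum_of_tsum_posTrace_ne_top {ι : Type*} {T : ι → H →L[ℂ] H}
    (hT : ∀ a, 0 ≤ T a) (h : ∑' a, posTrace (T a) ≠ ⊤) : TraceNormHasSum T (∑' a, T a) := by
  have hs := summable_of_tsum_posTrace_ne_top hT h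
  have h1 := ENNReal.tendsto_tsum_compl_atTop_zero h
  refine h1.congr fun s => ?_
  have h2 : HasSum (fun a : {a // a ∉ s} => T a) (∑' a, T a - ∑ a ∈ s, T a) := by
    rw [Finset.hasSum_compl_iff s, sub_add_cancel]
    exact hs.hasSum
  have h3 : 0 ≤ ∑' a, T a - ∑ a ∈ s, T a := h2.nonneg fun a => hT _
  rw [← neg_sub, traceNorm_neg, traceNorm_of_nonneg h3, posTrace_eq_tsum (fun a => hT _) h2]

/-! ### The projective measurement of a self-adjoint operator -/

theorem specProj_isSelfAdjoint (A : H →L[ℂ] H) (a : ℝ) : IsSelfAdjoint (specProj A a) :=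
  isSelfAdjoint_starProjection _

theorem specProj_mul_self (A : H →L[ℂ] H) (a : ℝ) : specProj A a * specProj A a = specProj A a :=
  Submodule.isIdempotentElem_starProjection _

theorem specProj_mul_of_ne {A : H →L[ℂ] H} (hA : IsSelfAdjoint A) {a b : ℝ} (hab : a ≠ b) :
    specProj A a * specProj A b = 0 := by
  refine Submodule.IsOrtho.starProjection_comp_starProjection ?_
  rw [Submodule.isOrtho_iff_inner_eq]
  intro u hu v hv
  have hu' : (a : ℂ) • u = A u := sub_eq_zero.mp hu
  have hv' : (b : ℂ) • v = A v := sub_eq_zero.mp hv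
  have h : inner ℂ (A u) v = inner ℂ u (A v) := by
    rw [← ContinuousLinearMap.adjoint_inner_left, hA.adjoint_eq]
  rw [← hu', ← hv', inner_smul_left, inner_smul_right, Complex.conj_ofReal] at h
  have h' : ((a : ℂ) - b) * inner ℂ u v = 0 := by rw [sub_mul, h, sub_self]
  refine (mul_eq_zero.mp h').resolve_left (sub_ne_zero.mpr ?_)
  exact_mod_cast hab

theorem pairwise_specProj {A : H →L[ℂ] H} (hA : IsSelfAdjoint A) :
    Pairwise fun a b : spectrum ℝ A => specProj A a * specProj A b = 0 :=
  fun _ _ h => specProj_mul_of_ne hA (Subtype.coe_ne_coe.mpr h)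

theorem State.op_nonneg (ρ : State H) : 0 ≤ ρ.op :=
  (ContinuousLinearMap.nonneg_iff_isPositive _).mpr ρ.isPositive

theorem State.posTrace_ne_top (ρ : State H) : posTrace ρ.op ≠ ⊤ := by
  rw [← traceNorm_of_nonneg ρ.op_nonneg]
  exact ρ.isTraceClass

theorem luders_nonneg (A : H →L[ℂ] H) (a : spectrum ℝ A) {T : H →L[ℂ] H} (hT : 0 ≤ T) :
    0 ≤ luders A a T :=
  (specProj_isSelfAdjoint A a).conjugate_nonneg hT

section

variable {A : H →L[ℂ] H} (ρ : State H)

theorem tsum_posTrace_luders_le (hA : IsSelfAdjoint A) :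
    ∑' a, posTrace (luders A a ρ.op) ≤ posTrace ρ.op :=
  tsum_posTrace_conj_le (fun a : spectrum ℝ A => specProj_isSelfAdjoint A a)
    (fun a => specProj_mul_self A a) (pairwise_specProj hA) ρ.op_nonneg

theorem tsum_posTrace_luders_ne_top (hA : IsSelfAdjoint A) :
    ∑' a, posTrace (luders A a ρ.op) ≠ ⊤ :=
  ne_top_of_le_ne_top ρ.posTrace_ne_top (tsum_posTrace_luders_le ρ hA)

theorem hasSum_luders (hA : IsSelfAdjoint A) :
    HasSum (fun a => luders A a ρ.op) (nonselective (luders A) ρ.op) :=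
  (summable_of_tsum_posTrace_ne_top (fun a => luders_nonneg A a ρ.op_nonneg)
    (tsum_posTrace_luders_ne_top ρ hA)).hasSum

theorem traceNormHasSum_luders (hA : IsSelfAdjoint A) :
    TraceNormHasSum (fun a => luders A a ρ.op) (nonselective (luders A) ρ.op) :=
  traceNormHasSum_of_tsum_posTrace_ne_top (fun a => luders_nonneg A a ρ.op_nonneg)
    (tsum_posTrace_luders_ne_top ρ hA)

theorem nonselective_luders_nonneg (hA : IsSelfAdjoint A) : 0 ≤ nonselective (luders A) ρ.op :=
  (hasSum_luders ρ hA).nonneg fun a => luders_nonneg A a ρ.op_nonneg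

theorem isTraceClass_nonselective_luders (hA : IsSelfAdjoint A) :
    IsTraceClass (nonselective (luders A) ρ.op) := by
  rw [IsTraceClass, traceNorm_of_nonneg (nonselective_luders_nonneg ρ hA),
    posTrace_eq_tsum (fun a => luders_nonneg A a ρ.op_nonneg) (hasSum_luders ρ hA)]
  exact tsum_posTrace_luders_ne_top ρ hA

/-- Orthogonality kills every block but the one at `a`. Together with the mirror identity below,
this is how `Λ_A(ρ)` enters the two bounds. -/
theorem specProj_mul_nonselective (hA : IsSelfAdjoint A) (a : spectrum ℝ A) :
    specProj A a * nonselective (luders A) ρ.op = luders A a ρ.op := by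
  have h := (hasSum_luders ρ hA).mul_left (specProj A a)
  refine h.unique ?_
  convert hasSum_single a fun b hb => ?_ using 1
  · simp only [luders, ← mul_assoc, specProj_mul_self]
  · simp only [luders, ← mul_assoc, pairwise_specProj hA hb.symm, zero_mul]

theorem nonselective_mul_specProj (hA : IsSelfAdjoint A) (a : spectrum ℝ A) :
    nonselective (luders A) ρ.op * specProj A a = luders A a ρ.op := by
  have h := (hasSum_luders ρ hA).mul_right (specProj A a)
  refine h.unique ?_
  convert hasSum_single a fun b hb => ?_ using 1
  · simp only [luders, mul_assoc, specProj_mul_self]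
  · simp only [luders, mul_assoc, pairwise_specProj hA hb, mul_zero]

end

/-! ### The two bounds -/

section

variable {ρ σ τ P Q : H →L[ℂ] H}

/-- Here `σ` commutes with `P`, so the order of `P` and `Q` against `σ` is immaterial under the
trace. -/
theorem trace_conj_mul_eq (hσ : IsTraceClass σ) (hσs : IsSelfAdjoint σ)
    (hPσ : P * σ = P * ρ * P) (hσP : σ * P = P * ρ * P) :
    trace (P * ρ * P * Q) = trace (σ * (P * Q)) ∧
      trace (P * ρ * P * Q) = trace (σ * (Q * P)) := by
  refine ⟨by rw [← hσP, mul_assoc], ?_⟩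
  rw [← hPσ, hσ.trace_cyclic hσs]

theorem trace_mul_circ (hσ : IsTraceClass σ) (hσs : IsSelfAdjoint σ)
    (hPσ : P * σ = P * ρ * P) (hσP : σ * P = P * ρ * P) (α : ℝ) :
    trace (σ * circ α P Q) = trace (P * ρ * P * Q) := by
  obtain ⟨h1, h2⟩ := trace_conj_mul_eq (Q := Q) hσ hσs hPσ hσP
  rw [circ, ← smul_mul_assoc, ← smul_mul_assoc, mul_add,
    trace_add (hσ.summable_diag_mul hσs _) (hσ.summable_diag_mul hσs _), smul_mul_assoc,
    smul_mul_assoc, mul_smul_comm, mul_smul_comm, trace_smul, trace_smul, ← h1, ← h2]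
  push_cast
  ring

omit [CompleteSpace H] in
theorem circ_one_sub (α : ℝ) : circ (1 - α) Q P = circ α P Q := by
  rw [circ, circ, sub_sub_cancel, add_comm]

theorem toReal_traceNorm_sub_le (hσ : IsTraceClass (σ - ρ)) (hτ : IsTraceClass (τ - ρ))
    (hρs : IsSelfAdjoint ρ) (hσs : IsSelfAdjoint σ) (hτs : IsSelfAdjoint τ) :
    (traceNorm (σ - τ)).toReal ≤ (traceNorm (σ - ρ)).toReal + (traceNorm (τ - ρ)).toReal := by
  rw [← ENNReal.toReal_add hσ hτ]
  refine ENNReal.toReal_mono (ENNReal.add_ne_top.mpr ⟨hσ, hτ⟩) ?_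
  have e : σ - τ = (σ - ρ) + -(τ - ρ) := by abel
  rw [e, ← traceNorm_neg (τ - ρ)]
  exact traceNorm_add_le (hσs.sub hρs) (hτs.sub hρs).neg

theorem norm_trace_sub_trace_le_circ
    (hρs : IsSelfAdjoint ρ) (hσs : IsSelfAdjoint σ) (hτs : IsSelfAdjoint τ)
    (hρ : IsTraceClass ρ) (hσ : IsTraceClass σ) (hτ : IsTraceClass τ)
    (hPσ : P * σ = P * ρ * P) (hσP : σ * P = P * ρ * P)
    (hQτ : Q * τ = Q * ρ * Q) (hτQ : τ * Q = Q * ρ * Q) (α : ℝ) :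
    ‖trace (P * ρ * P * Q) - trace (Q * ρ * Q * P)‖ ≤
      ‖circ α P Q‖ * ((traceNorm (σ - ρ)).toReal + (traceNorm (τ - ρ)).toReal) := by
  -- Exchanging `P` and `Q` turns `α` into `1 - α`; using `1 - α` for `τ` puts the same operator
  -- `circ α P Q` against both `σ` and `τ`.
  rw [← trace_mul_circ hσ hσs hPσ hσP α, ← trace_mul_circ hτ hτs hQτ hτQ (1 - α), circ_one_sub,
    ← trace_sub (hσ.summable_diag_mul hσs _) (hτ.summable_diag_mul hτs _), ← sub_mul]
  refine ((hσ.sub hτ hσs hτs).norm_trace_mul_le (hσs.sub hτs) _).trans ?_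
  gcongr
  exact toReal_traceNorm_sub_le (hσ.sub hρ hσs hρs) (hτ.sub hρ hτs hρs) hρs hσs hτs

theorem norm_trace_sub_trace_le_lie
    (hρs : IsSelfAdjoint ρ) (hσs : IsSelfAdjoint σ) (hτs : IsSelfAdjoint τ)
    (hρ : IsTraceClass ρ) (hσ : IsTraceClass σ) (hτ : IsTraceClass τ)
    (hPP : P * P = P) (hQQ : Q * Q = Q) (hP : ‖P‖ ≤ 1) (hQ : ‖Q‖ ≤ 1)
    (hPσ : P * σ = P * ρ * P) (hσP : σ * P = P * ρ * P)
    (hQτ : Q * τ = Q * ρ * Q) (hτQ : τ * Q = Q * ρ * Q) :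
    ‖trace (P * ρ * P * Q) - trace (Q * ρ * Q * P)‖ ≤
      ‖⁅P, Q⁆‖ * ((traceNorm (σ - ρ)).toReal + (traceNorm (τ - ρ)).toReal) := by
  have e1 : P * ⁅P, Q⁆ = P * Q - P * Q * P := by
    rw [Ring.lie_def, mul_sub, ← mul_assoc, ← mul_assoc, hPP]
  have e2 : ⁅P, Q⁆ * Q = P * Q - Q * P * Q := by
    rw [Ring.lie_def, sub_mul, mul_assoc, hQQ]
  -- Since `σ` commutes with `P` and `P² = P`, compressing `Q` to `P Q P` does not change its trace
  -- against `σ`.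
  have z1 : trace (σ * (P * ⁅P, Q⁆)) = 0 := by
    obtain ⟨h1, h2⟩ := trace_conj_mul_eq (Q := Q) hσ hσs hPσ hσP
    have h3 : σ * (P * Q * P) = P * σ * (Q * P) := by
      rw [hPσ, ← hσP]; simp only [mul_assoc]
    have h4 : trace (σ * (P * Q * P)) = trace (P * ρ * P * Q) := by
      rw [h3, hσ.trace_cyclic hσs, mul_assoc, hPP, h2]
    rw [e1, mul_sub, trace_sub (hσ.summable_diag_mul hσs _) (hσ.summable_diag_mul hσs _), h4, h1,
      sub_self]
  have z2 : trace (τ * (⁅P, Q⁆ * Q)) = 0 := by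
    obtain ⟨h1, h2⟩ := trace_conj_mul_eq (Q := P) hτ hτs hQτ hτQ
    have h3 : τ * (Q * P * Q) = Q * τ * (P * Q) := by
      rw [hQτ, ← hτQ]; simp only [mul_assoc]
    have h4 : trace (τ * (Q * P * Q)) = trace (Q * ρ * Q * P) := by
      rw [h3, hτ.trace_cyclic hτs, mul_assoc, hQQ, h2]
    rw [e2, mul_sub, trace_sub (hτ.summable_diag_mul hτs _) (hτ.summable_diag_mul hτs _), h4, h2,
      sub_self]
  have c1 : trace (P * ρ * P * Q) = trace (ρ * (P * Q * P)) := by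
    rw [mul_assoc, hρ.trace_cyclic hρs]
  have c2 : trace (Q * ρ * Q * P) = trace (ρ * (Q * P * Q)) := by
    rw [mul_assoc, hρ.trace_cyclic hρs]
  -- Subtracting `ρ` uses `P Q P - Q P Q = [P,Q] Q - P [P,Q]`; the `σ` and `τ` terms added here
  -- vanish by `z1` and `z2`.
  have key : trace (P * ρ * P * Q) - trace (Q * ρ * Q * P) =
      trace ((σ - ρ) * (P * ⁅P, Q⁆)) - trace ((τ - ρ) * (⁅P, Q⁆ * Q)) := by
    have s (X : H →L[ℂ] H) := hρ.summable_diag_mul hρs X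
    rw [sub_mul, sub_mul, trace_sub (hσ.summable_diag_mul hσs _) (s _),
      trace_sub (hτ.summable_diag_mul hτs _) (s _), z1, z2, e1, e2, mul_sub, mul_sub,
      trace_sub (s _) (s _), trace_sub (s _) (s _), c1, c2]
    ring
  rw [key, mul_add]
  refine (norm_sub_le _ _).trans (add_le_add ?_ ?_)
  · refine ((hσ.sub hρ hσs hρs).norm_trace_mul_le (hσs.sub hρs) _).trans ?_
    gcongr
    exact (norm_mul_le _ _).trans (mul_le_of_le_one_left (norm_nonneg _) hP)
  · refine ((hτ.sub hρ hτs hρs).norm_trace_mul_le (hτs.sub hρs) _).trans ?_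
    gcongr
    exact (norm_mul_le _ _).trans (mul_le_of_le_one_right (norm_nonneg _) hQ)

end

end QuantumInvasiveness

/-! ### The theorem: convergence and the two bounds combined -/

theorem mainTheorem10 {H : Type*} [NormedAddCommGroup H] [InnerProductSpace ℂ H] [CompleteSpace H]
    (A B : H →L[ℂ] H) (hA : IsSelfAdjoint A) (hAc : IsCompactOperator A)
    (hB : IsSelfAdjoint B) (hBc : IsCompactOperator B)
    (ρ : QuantumInvasiveness.State H) :
    (QuantumInvasiveness.TraceNormHasSum
        (fun a => QuantumInvasiveness.luders A a ρ.op)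
        (QuantumInvasiveness.nonselective (QuantumInvasiveness.luders A) ρ.op) ∧
      QuantumInvasiveness.IsTraceClass
        (QuantumInvasiveness.nonselective (QuantumInvasiveness.luders A) ρ.op - ρ.op)) ∧
    (QuantumInvasiveness.TraceNormHasSum
        (fun b => QuantumInvasiveness.luders B b ρ.op)
        (QuantumInvasiveness.nonselective (QuantumInvasiveness.luders B) ρ.op) ∧
      QuantumInvasiveness.IsTraceClass
        (QuantumInvasiveness.nonselective (QuantumInvasiveness.luders B) ρ.op - ρ.op)) ∧
    ∀ α : ℝ, α ∈ Set.Icc (0 : ℝ) 1 → ∀ (a : spectrum ℝ A) (b : spectrum ℝ B),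
      ‖QuantumInvasiveness.opProb ρ A B a b - QuantumInvasiveness.opProb ρ B A b a‖ ≤
        min ‖⁅QuantumInvasiveness.specProj A a, QuantumInvasiveness.specProj B b⁆‖
            ‖QuantumInvasiveness.circ α (QuantumInvasiveness.specProj A a)
              (QuantumInvasiveness.specProj B b)‖ *
          (QuantumInvasiveness.invasiveness (QuantumInvasiveness.luders A) ρ +
            QuantumInvasiveness.invasiveness (QuantumInvasiveness.luders B) ρ) := by
  have tc {C : H →L[ℂ] H} (hC : IsSelfAdjoint C) :=
    QuantumInvasiveness.isTraceClass_nonselective_luders ρ hC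
  have sa {C : H →L[ℂ] H} (hC : IsSelfAdjoint C) :=
    (QuantumInvasiveness.nonselective_luders_nonneg ρ hC).isSelfAdjoint
  have ρs := ρ.op_nonneg.isSelfAdjoint
  refine ⟨⟨QuantumInvasiveness.traceNormHasSum_luders ρ hA, (tc hA).sub ρ.isTraceClass (sa hA) ρs⟩,
    ⟨QuantumInvasiveness.traceNormHasSum_luders ρ hB, (tc hB).sub ρ.isTraceClass (sa hB) ρs⟩,
    fun α _ a b => ?_⟩
  have nonneg : 0 ≤ QuantumInvasiveness.invasiveness (QuantumInvasiveness.luders A) ρ +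
      QuantumInvasiveness.invasiveness (QuantumInvasiveness.luders B) ρ :=
    add_nonneg ENNReal.toReal_nonneg ENNReal.toReal_nonneg
  rw [min_mul_of_nonneg _ _ nonneg]
  exact le_min
    (QuantumInvasiveness.norm_trace_sub_trace_le_lie ρs (sa hA) (sa hB) ρ.isTraceClass
      (tc hA) (tc hB) (QuantumInvasiveness.specProj_mul_self A a)
      (QuantumInvasiveness.specProj_mul_self B b)
      (Submodule.starProjection_norm_le _) (Submodule.starProjection_norm_le _)
      (QuantumInvasiveness.specProj_mul_nonselective ρ hA a)
      (QuantumInvasiveness.nonselective_mul_specProj ρ hA a)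
      (QuantumInvasiveness.specProj_mul_nonselective ρ hB b)
      (QuantumInvasiveness.nonselective_mul_specProj ρ hB b))
    (QuantumInvasiveness.norm_trace_sub_trace_le_circ ρs (sa hA) (sa hB) ρ.isTraceClass
      (tc hA) (tc hB)
      (QuantumInvasiveness.specProj_mul_nonselective ρ hA a)
      (QuantumInvasiveness.nonselective_mul_specProj ρ hA a)
      (QuantumInvasiveness.specProj_mul_nonselective ρ hB b)
      (QuantumInvasiveness.nonselective_mul_specProj ρ hB b) α)
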